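/- **Theorem.** Let $\mathcal{A}$ be an abelian category with enough projectives, and let $\mathcal{X}$ be a full subcategory of $\mathcal{A}$, closed under isomorphisms and finite direct sums, which contains all projective objects of $\mathcal{A}$, is contravariantly finite (for every object $M$ of $\mathcal{A}$ there is a morphism $X \to M$ with $X \in \mathcal{X}$ through which every morphism from an object of $\mathcal{X}$ to $M$ factors), and is closed under kernels of epimorphisms (if $f : X \to Y$ is an epimorphism of $\mathcal{A}$ with $X, Y \in \mathcal{X}$, then $\operatorname{Ker} f \in \mathcal{X}$). Let $S_{\mathcal{X}}(\mathcal{A})$ be the full subcategory of the category of morphisms of $\mathcal{A}$ consisting of the monomorphisms $f : A \to B$ with $A$, $B$ and $\operatorname{Coker} f$ in $\mathcal{X}$. Let $\mathcal{V}$ be its full subcategory of the objects isomorphic to finite direct sums of objects of the form $(X \xrightarrow{\mathrm{Id}} X)$ or $(0 \to X)$ with $X \in \mathcal{X}$. Let $S_{\mathcal{X}}(\mathcal{A})/\mathcal{V}$ be the quotient category by the ideal of the morphisms that factor through an object of $\mathcal{V}$. Let $\underline{\mathcal{X}}$ be the stable category: its objects are those of $\mathcal{X}$, and its morphisms are the morphisms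 of $\mathcal{X}$ modulo those that factor through a projective object of $\mathcal{A}$. Let $\mathrm{mod}\text{-}\underline{\mathcal{X}}$ be the category of finitely presented additive functors $F : \underline{\mathcal{X}}^{\mathrm{op}} \to \mathcal{A}b$, i.e. those admitting an exact sequence $\underline{\mathcal{X}}(-, X) \to \underline{\mathcal{X}}(-, X') \to F \to 0$ with $X, X' \in \mathcal{X}$. By composition with the canonical functor $\mathcal{X} \to \underline{\mathcal{X}}$, regard the objects of $\mathrm{mod}\text{-}\underline{\mathcal{X}}$ as functors on $\mathcal{X}^{\mathrm{op}}$. Let $\Psi$ be the functor that sends $f : A \to B$ in $S_{\mathcal{X}}(\mathcal{A})$ to the cokernel of the morphism $\mathcal{A}(-, B)|_{\mathcal{X}} \to \mathcal{A}(-, \operatorname{Coker} f)|_{\mathcal{X}}$ given by the canonical projection $B \to \operatorname{Coker} f$, and a morphism $(\sigma_1, \sigma_2) : f \to f'$ to the morphism of cokernels induced by $\sigma_2$ and the map $\operatorname{Coker} f \to \operatorname{Coker} f'$ that it determines. Then $\Psi$ takes values in $\mathrm{mod}\text{-}\underline{\mathcal{X}}$ up to isomorphism, and it induces an equivalence of categories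 $$S_{\mathcal{X}}(\mathcal{A})/\mathcal{V} \;\simeq\; \mathrm{mod}\text{-}\underline{\mathcal{X}}.$$ That is, there is an equivalence $\Phi : S_{\mathcal{X}}(\mathcal{A})/\mathcal{V} \to \mathrm{mod}\text{-}\underline{\mathcal{X}}$ whose composite with the quotient functor $S_{\mathcal{X}}(\mathcal{A}) \to S_{\mathcal{X}}(\mathcal{A})/\mathcal{V}$ is naturally isomorphic, as a functor into functors on $\mathcal{X}^{\mathrm{op}}$, to $\Psi$. -/

import Mathlib

open CategoryTheory CategoryTheory.Limits
open scoped ZeroObject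

universe v u

/-! ### Ideals of a preadditive category and additive quotients -/

section Ideals

/-- A two-sided ideal of a preadditive category: a subgroup of every Hom-group, stable under
composition with arbitrary morphisms on both sides. -/
structure HomIdeal (C : Type u) [Category.{v} C] [Preadditive C] where
  carrier (X Y : C) : AddSubgroup (X ⟶ Y)
  comp_left {X Y Z : C} (f : X ⟶ Y) {g : Y ⟶ Z} (hg : g ∈ carrier Y Z) : f ≫ g ∈ carrier X Z
  comp_right {X Y Z : C} {f : X ⟶ Y} (g : Y ⟶ Z) (hf : f ∈ carrier X Y) : f ≫ g ∈ carrier X Z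

namespace HomIdeal

variable {C : Type u} [Category.{v} C] [Preadditive C]

/-- Congruence modulo an ideal. -/
def rel (I : HomIdeal C) : HomRel C := fun X Y f g => f - g ∈ I.carrier X Y

instance (I : HomIdeal C) : Congruence I.rel where
  equivalence :=
    { refl := fun f => by simp [rel]
      symm := fun {f g} h => by
        have h' := neg_mem (show f - g ∈ I.carrier _ _ from h)
        rw [neg_sub] at h'
        exact h'
      trans := fun {f g k} h h' => by
        have h'' := add_mem (show f - g ∈ I.carrier _ _ from h)
          (show g - k ∈ I.carrier _ _ from h')
        rw [sub_add_sub_cancel] at h''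
        exact h'' }
  comp_left f g g' h := by
    have h' := I.comp_left f (show g - g' ∈ I.carrier _ _ from h)
    rw [Preadditive.comp_sub] at h'
    exact h'
  comp_right {_ _ _ f f'} g h := by
    have h' := I.comp_right g (show f - f' ∈ I.carrier _ _ from h)
    rw [Preadditive.sub_comp] at h'
    exact h'

/-- The quotient category `C / I`: the objects of `C`, with
`Hom (X, Y) = Hom_C (X, Y) / I (X, Y)`. -/
abbrev Quot (I : HomIdeal C) := CategoryTheory.Quotient I.rel

/-- The canonical functor `C ⥤ C / I`. -/
abbrev toQuot (I : HomIdeal C) : C ⥤ I.Quot := CategoryTheory.Quotient.functor I.rel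

instance (I : HomIdeal C) : Preadditive I.Quot :=
  CategoryTheory.Quotient.preadditive I.rel (fun _ _ f₁ f₂ g₁ g₂ h h' => by
    have h'' := add_mem (show f₁ - f₂ ∈ I.carrier _ _ from h)
      (show g₁ - g₂ ∈ I.carrier _ _ from h')
    rw [← add_sub_add_comm] at h''
    exact h'')

/-- The ideal of all morphisms that factor through an object satisfying `Q`, where `Q` is
nonempty and closed under direct sums. -/
def ofObjects [HasBinaryBiproducts C] (Q : ObjectProperty C) (hne : ∃ Z, Q Z)
    (hadd : ∀ Z W, Q Z → Q W → Q (Z ⊞ W)) : HomIdeal C where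
  carrier X Y :=
    { carrier := {f | ∃ (Z : C) (_ : Q Z) (a : X ⟶ Z) (b : Z ⟶ Y), a ≫ b = f}
      add_mem' := by
        rintro _ _ ⟨Z, hZ, a, b, rfl⟩ ⟨W, hW, c, d, rfl⟩
        exact ⟨Z ⊞ W, hadd Z W hZ hW, biprod.lift a c, biprod.desc b d, biprod.lift_desc⟩
      zero_mem' := by
        obtain ⟨Z, hZ⟩ := hne
        exact ⟨Z, hZ, 0, 0, by simp⟩
      neg_mem' := by
        rintro _ ⟨Z, hZ, a, b, rfl⟩
        exact ⟨Z, hZ, -a, b, by simp⟩ }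
  comp_left := by
    rintro X Y T f _ ⟨Z, hZ, a, b, rfl⟩
    exact ⟨Z, hZ, f ≫ a, b, by simp⟩
  comp_right := by
    rintro X Y T _ g ⟨Z, hZ, a, b, rfl⟩
    exact ⟨Z, hZ, a, b ≫ g, by simp⟩

/-- The restriction of an ideal to a full subcategory. -/
def restrict (I : HomIdeal C) (P : ObjectProperty C) : HomIdeal P.FullSubcategory where
  carrier X Y := (I.carrier X.obj Y.obj).comap (P.ι.mapAddHom (X := X) (Y := Y))
  comp_left f _ hg := I.comp_left f.hom hg
  comp_right g hf := I.comp_right g.hom hf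

end HomIdeal

/-- A direct sum over a disjoint union of index types is the sum of the two direct sums. -/
noncomputable def biproductSumIso {C : Type u} [Category.{v} C] [Preadditive C]
    [HasFiniteBiproducts C] [HasBinaryBiproducts C] {ι κ : Type} [Finite ι] [Finite κ]
    (H : ι ⊕ κ → C) :
    ⨁ H ≅ (⨁ fun i => H (Sum.inl i)) ⊞ (⨁ fun k => H (Sum.inr k)) where
  hom := biprod.lift (biproduct.lift fun i => biproduct.π H (Sum.inl i))
    (biproduct.lift fun k => biproduct.π H (Sum.inr k))
  inv := biproduct.lift fun
    | Sum.inl i => biprod.fst ≫ biproduct.π _ i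
    | Sum.inr k => biprod.snd ≫ biproduct.π _ k
  hom_inv_id := by
    apply biproduct.hom_ext
    rintro (i | k) <;> simp
  inv_hom_id := by
    apply biprod.hom_ext <;> apply biproduct.hom_ext <;> intro j <;> simp

end Ideals

/-! ### Finitely presented functors -/

section FinitelyPresented

/-- A finitely presented right `C`-module: an additive functor `F : Cᵒᵖ ⥤ Ab` admitting an exact
sequence `C(-, X) ⟶ C(-, X') ⟶ F ⟶ 0`. -/
def IsFinPresModule (C : Type u) [Category.{v} C] [Preadditive C] :
    ObjectProperty (Cᵒᵖ ⥤ AddCommGrpCat.{v}) := fun F =>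
  F.Additive ∧ ∃ (X X' : C) (α : preadditiveYoneda.obj X ⟶ preadditiveYoneda.obj X')
    (p : preadditiveYoneda.obj X' ⟶ F) (w : α ≫ p = 0), (ShortComplex.mk α p w).Exact ∧ Epi p

/-- The category `mod-C` of finitely presented right `C`-modules, a full subcategory of the
category of functors `Cᵒᵖ ⥤ Ab`. -/
abbrev FinPresMod (C : Type u) [Category.{v} C] [Preadditive C] :=
  (IsFinPresModule C).FullSubcategory

end FinitelyPresented

section Subcategories

variable {A : Type u} [Category.{v} A] [Abelian A] (P : ObjectProperty A)

/-- Every object `M` of `A` has a right `P`-approximation: a morphism `φ : X ⟶ M` from an object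
of `P` through which every morphism from an object of `P` to `M` factors. -/
def IsContravariantlyFinite : Prop :=
  ∀ M : A, ∃ (X : A) (_ : P X) (φ : X ⟶ M),
    ∀ (X' : A) (_ : P X') (g : X' ⟶ M), ∃ h : X' ⟶ X, h ≫ φ = g

/-- Kernels of epimorphisms between objects of `P` belong to `P`. -/
def IsClosedUnderKernelsOfEpis : Prop :=
  ∀ ⦃X Y : A⦄ (f : X ⟶ Y), Epi f → P X → P Y → P (kernel f)

/-! ### The stable category -/

/-- The ideal of the full subcategory `P` of the morphisms that factor through a projective object
of `A`. -/
noncomputable def projIdeal : HomIdeal P.FullSubcategory :=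
  (HomIdeal.ofObjects (fun Z : A => Projective Z) ⟨0, inferInstance⟩
    (fun _ _ _ _ => inferInstance)).restrict P

/-- The stable category of `P`. -/
abbrev StableCat := (projIdeal P).Quot

/-- Restriction along the canonical functor `P ⥤ StableCat P`, regarding a finitely presented
module over the stable category as a functor on `P`. -/
noncomputable abbrev stableRestrict :
    FinPresMod (StableCat P) ⥤ (P.FullSubcategoryᵒᵖ ⥤ AddCommGrpCat.{v}) :=
  (IsFinPresModule (StableCat P)).ι ⋙
    (Functor.whiskeringLeft _ _ _).obj (projIdeal P).toQuot.op

/-! ### The monomorphism category -/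

/-- The property of a morphism of `A` of being a monomorphism whose source, target and cokernel
belong to `P`. -/
def IsMonoIn : ObjectProperty (Arrow A) := fun f =>
  Mono f.hom ∧ P f.left ∧ P f.right ∧ P (cokernel f.hom)

/-- The category `S_P(A)`, a full subcategory of the category of morphisms of `A`. -/
abbrev MonoCat := (IsMonoIn P).FullSubcategory

instance coker_additive : (coker A).Additive where
  map_add {f g a b} := by
    apply (cancel_epi (cokernel.π f.hom)).1
    refine Eq.trans ?_ (Preadditive.comp_add _ _ _ (cokernel.π f.hom) _ _).symm
    simp [coker]
    rfl

instance [P.IsClosedUnderFiniteProducts] : (IsMonoIn P).IsClosedUnderFiniteProducts where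
  isClosedUnderLimitsOfShape J _ := ⟨by
    rintro W ⟨h⟩
    have key (F : Arrow A ⥤ A) [F.Additive] (hF : ∀ f, IsMonoIn P f → P (F.obj f)) :
        Nonempty (IsLimit (F.mapCone h.cone)) ∧ P (F.obj W) := by
      have : PreservesFiniteBiproducts F := inferInstance
      have : PreservesLimitsOfShape (Discrete J) F :=
        preservesProductsOfShape_of_preservesBiproductsOfShape F
      have hl := isLimitOfPreserves F h.isLimit
      exact ⟨⟨hl⟩, P.prop_of_isLimit hl (fun j => hF _ (h.prop_diag_obj j))⟩
    refine ⟨⟨fun x y hxy => ?_⟩, (key Arrow.leftFunc fun f hf => hf.2.1).2,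
      (key Arrow.rightFunc fun f hf => hf.2.2.1).2, (key (coker A) fun f hf => hf.2.2.2).2⟩
    obtain ⟨hl⟩ := (key Arrow.leftFunc fun f hf => hf.2.1).1
    refine hl.hom_ext fun j => ?_
    have := (h.prop_diag_obj j).1
    apply (cancel_mono (h.diag.obj j).hom).1
    have hw : (h.π.app j).left ≫ (h.diag.obj j).hom = W.hom ≫ (h.π.app j).right :=
      Arrow.w (h.π.app j)
    change (x ≫ (h.π.app j).left) ≫ _ = (y ≫ (h.π.app j).left) ≫ _
    rw [Category.assoc, Category.assoc, hw, ← Category.assoc, ← Category.assoc, hxy]⟩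

instance [P.IsClosedUnderFiniteProducts] : HasFiniteBiproducts (MonoCat P) :=
  HasFiniteBiproducts.of_hasFiniteProducts

instance [P.IsClosedUnderFiniteProducts] : HasBinaryBiproducts (MonoCat P) :=
  hasBinaryBiproducts_of_finite_biproducts _

/-- The objects of `S_P(A)` isomorphic to `X ⟶ X` (the identity) or to `0 ⟶ X`, for some `X`
in `P`. -/
def IsElementary : ObjectProperty (MonoCat P) := fun Z =>
  ∃ X : A, P X ∧ (Nonempty (Z.obj ≅ Arrow.mk (𝟙 X)) ∨
    Nonempty (Z.obj ≅ Arrow.mk (0 : (0 : A) ⟶ X)))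

variable [P.IsClosedUnderFiniteProducts]

/-- The objects of the subcategory `V` of `S_P(A)`: finite direct sums of elementary objects. -/
def InV : ObjectProperty (MonoCat P) := fun Z =>
  ∃ (ι : Type) (_ : Finite ι) (F : ι → MonoCat P),
    (∀ i, IsElementary P (F i)) ∧ Nonempty (Z ≅ ⨁ F)

/-- The ideal of `S_P(A)` of the morphisms that factor through an object of `V`. -/
noncomputable def idealV : HomIdeal (MonoCat P) :=
  HomIdeal.ofObjects (InV P)
    ⟨⨁ (fun i : PEmpty => i.elim), PEmpty, inferInstance, _, fun i => i.elim, ⟨Iso.refl _⟩⟩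
    (by
      rintro Z W ⟨ι, _, F, hF, ⟨e⟩⟩ ⟨κ, _, G, hG, ⟨e'⟩⟩
      refine ⟨ι ⊕ κ, inferInstance, Sum.elim F G, ?_, ⟨?_⟩⟩
      · rintro (i | k)
        · exact hF i
        · exact hG k
      · exact biprod.mapIso e e' ≪≫ (biproductSumIso (Sum.elim F G)).symm)

end Subcategories

/-! ### The functor `Ψ` -/

section Psi

variable {A : Type u} [Category.{v} A] [Abelian A] (P : ObjectProperty A)

/-- The functor sending an object `f : X ⟶ Y` of `S_P(A)` to the projection `Y ⟶ Coker f`, a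
morphism of the full subcategory `P`. -/
noncomputable def projToCoker : MonoCat P ⥤ Arrow P.FullSubcategory where
  obj f := Arrow.mk (Y := (⟨cokernel f.obj.hom, f.property.2.2.2⟩ : P.FullSubcategory))
    (X := ⟨f.obj.right, f.property.2.2.1⟩) (ObjectProperty.homMk (cokernel.π f.obj.hom))
  map {f g} σ := Arrow.homMk (ObjectProperty.homMk σ.hom.right)
    (ObjectProperty.homMk (cokernel.map f.obj.hom g.obj.hom σ.hom.left σ.hom.right
      (Arrow.w σ.hom).symm)) (by ext; simp)

/-- The functor `Ψ`, with values regarded as functors on `P`: it sends `f : X ⟶ Y` in `S_P(A)` to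
the cokernel of `(-, Y) ⟶ (-, Coker f)`, and a morphism to the induced map on cokernels. -/
noncomputable def Psi : MonoCat P ⥤ (P.FullSubcategoryᵒᵖ ⥤ AddCommGrpCat.{v}) :=
  projToCoker P ⋙ preadditiveYoneda.mapArrow ⋙ coker _

end Psi

/-! ### Functors with values in abelian groups -/

section AbValued

variable {C : Type u} [Category.{v} C] {F G H : C ⥤ AddCommGrpCat.{v}}

/-! An object `f : A ⟶ B` of `S_P(A)` is the kernel of an epimorphism `p : B ⟶ C` with `C = Coker
f`. Since `p` is epi, every morphism to `C` that factors through a projective lifts along `p`. Hence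
a morphism to `C` represents zero in the cokernel of `(-, B) ⟶ (-, C)` over the stable category
exactly when it lifts along `p` in `P` itself (`stableCokerπ_app_eq_zero_iff`). So `Psi` agrees with
`stableCoker`, the same cokernel formed over `StableCat P` (`psiIso`), and it remains to study
`stableCoker`.

Full: by Yoneda a natural transformation comes from some `c : C ⟶ C'`; the criterion extends `c` to
a commutative square with the projections, and passing to kernels gives a morphism of `S_P(A)`.
Kernel: a morphism is sent to zero exactly when its map `C ⟶ C'` lifts to `B'`
(`stableCoker_map_eq_iff`), which characterizes the ideal of `V` (`mem_idealV_iff`). Dense: adding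
to the source of a stable morphism a projective mapping onto its target makes it an epimorphism
without changing its cokernel functor (`exists_epi_of_stable`, `exists_stableCoker_iso`). -/

lemma app_surjective_of_epi (p : F ⟶ G) [Epi p] (T : C) : Function.Surjective (p.app T) :=
  (AddCommGrpCat.epi_iff_surjective _).1 inferInstance

lemma cokernel_π_app_eq_zero_iff (α : F ⟶ G) (T : C) (g : G.obj T) :
    (cokernel.π α).app T g = 0 ↔ ∃ x : F.obj T, α.app T x = g := by
  constructor
  · intro h
    have hex := (ShortComplex.exact_cokernel α).map ((evaluation C AddCommGrpCat.{v}).obj T)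
    exact (ShortComplex.ab_exact_iff _).1 hex g h
  · rintro ⟨x, rfl⟩
    exact congrArg (fun β : F ⟶ cokernel α => β.app T x) (cokernel.condition α)

lemma additive_of_epi [Preadditive C] (p : F ⟶ G) [Epi p] [F.Additive] : G.Additive where
  map_add {X Y f g} := by
    ext x
    obtain ⟨y, rfl⟩ := app_surjective_of_epi p X x
    have hn (k : X ⟶ Y) : G.map k (p.app X y) = p.app Y (F.map k y) :=
      (NatTrans.naturality_apply p k y).symm
    change G.map (f + g) (p.app X y) = G.map f (p.app X y) + G.map g (p.app X y)
    rw [hn, hn, hn, F.map_add, ← map_add]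
    rfl

end AbValued

/-! ### The quotient by an ideal -/

namespace HomIdeal

variable {C : Type u} [Category.{v} C] [Preadditive C] (I : HomIdeal C)

instance : I.toQuot.Additive where
  map_add := rfl

lemma toQuot_map_eq_iff {X Y : C} (f g : X ⟶ Y) :
    I.toQuot.map f = I.toQuot.map g ↔ f - g ∈ I.carrier X Y :=
  CategoryTheory.Quotient.functor_map_eq_iff I.rel f g

end HomIdeal

/-! ### Morphisms of arrows whose map on cokernels lifts -/

section CokerLift

variable {A : Type u} [Category.{v} A] [Abelian A]

/-- The ideal of the category of morphisms of `A` of the morphisms `f ⟶ g` whose induced morphism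
`Coker f ⟶ Coker g` lifts to the target of `g`. -/
noncomputable def cokerLiftIdeal : HomIdeal (Arrow A) where
  carrier f g :=
    { carrier := {σ | ∃ h : (coker A).obj f ⟶ Arrow.rightFunc.obj g,
        h ≫ (coker.π A).app g = (coker A).map σ}
      add_mem' := by
        rintro σ τ ⟨h, hh⟩ ⟨k, hk⟩
        exact ⟨h + k, by rw [Preadditive.add_comp, hh, hk, Functor.map_add]⟩
      zero_mem' := ⟨0, by rw [Functor.map_zero, zero_comp]⟩
      neg_mem' := by
        rintro σ ⟨h, hh⟩
        exact ⟨-h, by rw [Preadditive.neg_comp, hh, Functor.map_neg]⟩ }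
  comp_left := by
    rintro f g k σ τ ⟨h, hh⟩
    exact ⟨(coker A).map σ ≫ h, by rw [Category.assoc, hh, Functor.map_comp]⟩
  comp_right := by
    rintro f g k σ τ ⟨h, hh⟩
    exact ⟨h ≫ Arrow.rightFunc.map τ, by
      rw [Functor.map_comp, ← hh, Category.assoc, Category.assoc, (coker.π A).naturality]⟩

lemma id_mem_cokerLiftIdeal_of_iso {f g : Arrow A} (e : f ≅ g)
    (h : 𝟙 g ∈ cokerLiftIdeal.carrier g g) : 𝟙 f ∈ cokerLiftIdeal.carrier f f := by
  have := cokerLiftIdeal.comp_left e.hom (cokerLiftIdeal.comp_right e.inv h)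
  simpa using this

variable (P : ObjectProperty A)

/-- The cokernel of an identity is zero, and the projection from `X` to the cokernel of `0 ⟶ X` is
invertible, so its inverse is the required lift. -/
lemma IsElementary.id_mem_cokerLiftIdeal {Z : MonoCat P} (hZ : IsElementary P Z) :
    𝟙 Z.obj ∈ cokerLiftIdeal.carrier Z.obj Z.obj := by
  obtain ⟨X, -, ⟨⟨e⟩⟩ | ⟨⟨e⟩⟩⟩ := hZ
  · refine id_mem_cokerLiftIdeal_of_iso e ⟨0, ?_⟩
    apply (cancel_epi (cokernel.π (𝟙 X))).1
    have : cokernel.π (𝟙 X) = 0 := (Category.id_comp _).symm.trans (cokernel.condition (𝟙 X))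
    rw [this]
    exact zero_comp.trans zero_comp.symm
  · refine id_mem_cokerLiftIdeal_of_iso e ⟨cokernel.desc _ (𝟙 X) zero_comp, ?_⟩
    apply (cancel_epi (cokernel.π (0 : (0 : A) ⟶ X))).1
    exact ((cokernel.π_desc_assoc _ _ _ _).trans (Category.id_comp _)).trans
      (((coker A).map_id _).symm ▸ (Category.comp_id _).symm)

variable [P.IsClosedUnderFiniteProducts]

/-- The identity of a direct sum is a sum of morphisms through the summands, and an ideal is closed
under sums and compositions. -/
lemma InV.id_mem_cokerLiftIdeal {Z : MonoCat P} (hZ : InV P Z) :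
    𝟙 Z.obj ∈ cokerLiftIdeal.carrier Z.obj Z.obj := by
  obtain ⟨ι, _, F, hF, ⟨e⟩⟩ := hZ
  refine id_mem_cokerLiftIdeal_of_iso ((IsMonoIn P).ι.mapIso e) ?_
  have := Fintype.ofFinite ι
  have hid : 𝟙 ((IsMonoIn P).ι.obj (⨁ F)) =
      ∑ i, (IsMonoIn P).ι.map (biproduct.π F i) ≫ 𝟙 (F i).obj ≫
        (IsMonoIn P).ι.map (biproduct.ι F i) := by
    classical
    rw [← CategoryTheory.Functor.map_id, ← biproduct.total, Functor.map_sum]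
    exact Finset.sum_congr rfl fun i _ => by
      rw [Functor.map_comp]
      exact congrArg _ (Category.id_comp _).symm
  rw [hid]
  exact sum_mem fun i _ => cokerLiftIdeal.comp_left _ (cokerLiftIdeal.comp_right _
    (IsElementary.id_mem_cokerLiftIdeal P (hF i)))

lemma elementary_inV {Z : MonoCat P} (hZ : IsElementary P Z) : InV P Z :=
  ⟨PUnit, inferInstance, fun _ => Z, fun _ => hZ, ⟨(biproductUniqueIso fun _ : PUnit => Z).symm⟩⟩

lemma prop_zero_of_isClosedUnderFiniteProducts : P (0 : A) :=
  P.prop_of_isLimit_fan (J := PEmpty.{1}) (f := PEmpty.elim) (F := Fan.mk (0 : A) fun j => j.elim)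
    (Fan.IsLimit.mk _ (fun _ => 0) (fun _ j => j.elim) fun _ _ _ => (isZero_zero A).eq_of_tgt _ _)
    fun j => j.elim

lemma isMonoIn_id {X : A} [P.IsClosedUnderIsomorphisms] (hX : P X) :
    IsMonoIn P (Arrow.mk (𝟙 X)) :=
  ⟨inferInstanceAs (Mono (𝟙 X)), hX, hX,
    P.prop_of_iso (cokernel.ofEpi (𝟙 X)).symm (prop_zero_of_isClosedUnderFiniteProducts P)⟩

lemma isMonoIn_zero {X : A} [P.IsClosedUnderIsomorphisms] (hX : P X) :
    IsMonoIn P (Arrow.mk (0 : (0 : A) ⟶ X)) :=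
  ⟨inferInstanceAs (Mono (0 : (0 : A) ⟶ X)), (prop_zero_of_isClosedUnderFiniteProducts P), hX,
    P.prop_of_iso cokernelZeroIsoTarget.symm hX⟩

/-- The ideal of `S_P(A)` given by `V` consists of the morphisms whose induced map on cokernels
lifts. -/
lemma mem_idealV_iff [P.IsClosedUnderIsomorphisms] {f g : MonoCat P} (σ : f ⟶ g) :
    σ ∈ (idealV P).carrier f g ↔ σ.hom ∈ cokerLiftIdeal.carrier f.obj g.obj := by
  constructor
  · rintro ⟨Z, hZ, a, b, rfl⟩
    simpa using! cokerLiftIdeal.comp_left a.hom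
      (cokerLiftIdeal.comp_right b.hom (InV.id_mem_cokerLiftIdeal P hZ))
  · rintro ⟨h', hh⟩
    obtain ⟨h, rfl⟩ : ∃ h : cokernel f.obj.hom ⟶ g.obj.right, h = h' := ⟨h', rfl⟩
    have : Mono g.obj.hom := g.property.1
    have hπ : cokernel.π f.obj.hom ≫ h ≫ cokernel.π g.obj.hom =
        σ.hom.right ≫ cokernel.π g.obj.hom :=
      (congrArg (cokernel.π f.obj.hom ≫ ·) hh).trans (cokernel.π_desc _ _ _)
    -- Subtracting the part that passes through the lift `h` leaves a morphism that dies in `Coker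
    -- g`, hence lands in the source of `g`.
    let k : f.obj.right ⟶ g.obj.left := Abelian.monoLift g.obj.hom
      (σ.hom.right - cokernel.π f.obj.hom ≫ h) (by simp [hπ])
    have hk : k ≫ g.obj.hom = σ.hom.right - cokernel.π f.obj.hom ≫ h :=
      Abelian.monoLift_comp _ _ _
    have hfk : f.obj.hom ≫ k = σ.hom.left := by
      apply (cancel_mono g.obj.hom).1
      have := Arrow.w σ.hom
      rw [Category.assoc, hk, Preadditive.comp_sub, cokernel.condition_assoc, zero_comp, sub_zero]
      exact this.symm
    -- The two parts of `σ` factor through elementary objects: `k` through the identity of the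
    -- target of `f`, `h` through `0 ⟶ Coker f`.
    let U : MonoCat P := ⟨_, isMonoIn_id P f.property.2.2.1⟩
    let W : MonoCat P := ⟨_, isMonoIn_zero P f.property.2.2.2⟩
    let a : f ⟶ U := ObjectProperty.homMk (Arrow.homMk f.obj.hom (𝟙 _) (by simp [U]))
    let b : U ⟶ g := ObjectProperty.homMk (Arrow.homMk k (k ≫ g.obj.hom) (by simp [U]))
    let c : f ⟶ W := ObjectProperty.homMk (Arrow.homMk 0 (cokernel.π f.obj.hom) (by simp [W]))
    let d : W ⟶ g := ObjectProperty.homMk (Arrow.homMk 0 h (by simp [W]))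
    have hσ : σ = a ≫ b + c ≫ d := by
      ext
      · change σ.hom.left = f.obj.hom ≫ k + (0 : f.obj.left ⟶ 0) ≫ 0
        simp [hfk]
      · change σ.hom.right = 𝟙 _ ≫ k ≫ g.obj.hom + cokernel.π f.obj.hom ≫ h
        simp [hk]
    rw [hσ]
    exact add_mem
      ⟨U, elementary_inV P ⟨_, f.property.2.2.1, .inl ⟨Iso.refl _⟩⟩, a, b, rfl⟩
      ⟨W, elementary_inV P ⟨_, f.property.2.2.2, .inr ⟨Iso.refl _⟩⟩, c, d, rfl⟩

end CokerLift

/-! ### The Yoneda lemma for additive representable functors -/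

section Yoneda

variable {C : Type u} [Category.{v} C] [Preadditive C]

lemma preadditiveYoneda_app_apply {X : C} {F : Cᵒᵖ ⥤ AddCommGrpCat.{v}}
    (φ : preadditiveYoneda.obj X ⟶ F) {Y : C} (g : Y ⟶ X) :
    φ.app (.op Y) g = F.map g.op (φ.app (.op X) (𝟙 X)) := by
  refine Eq.trans ?_ (NatTrans.naturality_apply φ g.op (𝟙 X))
  exact congrArg (φ.app (.op Y)) (Category.comp_id g).symm

lemma preadditiveYoneda_hom_ext {X : C} {F : Cᵒᵖ ⥤ AddCommGrpCat.{v}}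
    {φ ψ : preadditiveYoneda.obj X ⟶ F} (h : φ.app (.op X) (𝟙 X) = ψ.app (.op X) (𝟙 X)) :
    φ = ψ := by
  ext Y g
  obtain ⟨Y⟩ := Y
  exact (preadditiveYoneda_app_apply φ g).trans
    ((congrArg _ h).trans (preadditiveYoneda_app_apply ψ g).symm)

instance : (preadditiveYoneda : C ⥤ Cᵒᵖ ⥤ AddCommGrpCat.{v}).Additive where
  map_add {X Y f g} := by
    ext Z h
    exact Preadditive.comp_add _ _ _ h f g

end Yoneda

/-! ### The cokernel functor over the stable category: fullness and kernel -/

section StableCoker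

variable {A : Type u} [Category.{v} A] [Abelian A] (P : ObjectProperty A)

/-- The functor sending `f : X ⟶ Y` in `S_P(A)` to the cokernel of `(-, Y) ⟶ (-, Coker f)` taken
over the stable category. -/
noncomputable def stableCoker : MonoCat P ⥤ ((StableCat P)ᵒᵖ ⥤ AddCommGrpCat.{v}) :=
  projToCoker P ⋙ (projIdeal P).toQuot.mapArrow ⋙ preadditiveYoneda.mapArrow ⋙ coker _

/-- The projection from the functor represented by `Coker f` onto the value of `stableCoker` at
`f`. -/
noncomputable def stableCokerπ (f : MonoCat P) :
    preadditiveYoneda.obj ((projIdeal P).toQuot.obj ((projToCoker P).obj f).right) ⟶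
      (stableCoker P).obj f :=
  cokernel.π (preadditiveYoneda.map ((projIdeal P).toQuot.map ((projToCoker P).obj f).hom))

instance (f : MonoCat P) : Epi (stableCokerπ P f) :=
  inferInstanceAs (Epi (cokernel.π _))

lemma stableCokerπ_naturality {f g : MonoCat P} (σ : f ⟶ g) :
    stableCokerπ P f ≫ (stableCoker P).map σ =
      preadditiveYoneda.map ((projIdeal P).toQuot.map ((projToCoker P).map σ).right) ≫
        stableCokerπ P g :=
  cokernel.π_desc _ _ _

lemma stableCoker_isFinPresModule (f : MonoCat P) :
    IsFinPresModule (StableCat P) ((stableCoker P).obj f) :=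
  ⟨additive_of_epi (stableCokerπ P f), _, _, _, stableCokerπ P f, cokernel.condition _,
    ShortComplex.exact_cokernel _, inferInstance⟩

/-- A morphism that factors through a projective object lifts along an epimorphism. -/
lemma exists_lift_of_mem_projIdeal {X Y Z : P.FullSubcategory} (p : Y ⟶ Z) [Epi p.hom] {g : X ⟶ Z}
    (hg : g ∈ (projIdeal P).carrier X Z) : ∃ h : X ⟶ Y, h ≫ p = g := by
  obtain ⟨Q, _, a, b, hab⟩ := hg
  refine ⟨ObjectProperty.homMk (a ≫ Projective.factorThru b p.hom), ?_⟩
  ext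
  simpa using! hab

instance (f : MonoCat P) : Epi ((projToCoker P).obj f).hom.hom :=
  inferInstanceAs (Epi (cokernel.π f.obj.hom))

/-- If `g` vanishes in the cokernel, it agrees with some `x' ≫ p` up to a morphism through a
projective. That error term also lifts along the epimorphism `p`, so `g` lifts on the nose. -/
lemma stableCokerπ_app_eq_zero_iff (f : MonoCat P) {Y : P.FullSubcategory}
    (g : Y ⟶ ((projToCoker P).obj f).right) :
    (stableCokerπ P f).app (.op ((projIdeal P).toQuot.obj Y)) ((projIdeal P).toQuot.map g) = 0 ↔
      ∃ h : Y ⟶ ((projToCoker P).obj f).left, h ≫ ((projToCoker P).obj f).hom = g := by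
  refine (cokernel_π_app_eq_zero_iff _ _ _).trans ⟨?_, ?_⟩
  · rintro ⟨x, hx⟩
    obtain ⟨x', rfl⟩ := (projIdeal P).toQuot.map_surjective x
    have hx' : (projIdeal P).toQuot.map g =
        (projIdeal P).toQuot.map (x' ≫ ((projToCoker P).obj f).hom) := hx.symm
    obtain ⟨h, hh⟩ := exists_lift_of_mem_projIdeal P ((projToCoker P).obj f).hom
      (((projIdeal P).toQuot_map_eq_iff _ _).1 hx')
    exact ⟨h + x', by rw [Preadditive.add_comp, hh, sub_add_cancel]⟩
  · rintro ⟨h, rfl⟩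
    exact ⟨(projIdeal P).toQuot.map h, rfl⟩

lemma stableCoker_map_eq_iff [P.IsClosedUnderIsomorphisms] [P.IsClosedUnderFiniteProducts]
    {f g : MonoCat P} (σ τ : f ⟶ g) :
    (stableCoker P).map σ = (stableCoker P).map τ ↔ σ - τ ∈ (idealV P).carrier f g := by
  rw [mem_idealV_iff, ← cancel_epi (stableCokerπ P f), stableCokerπ_naturality,
    stableCokerπ_naturality, ← sub_eq_zero, ← Preadditive.sub_comp, ← Functor.map_sub,
    ← Functor.map_sub]
  -- By Yoneda, the vanishing is tested on the identity of `Coker f`.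
  trans (stableCokerπ P g).app (.op ((projIdeal P).toQuot.obj ((projToCoker P).obj f).right))
    ((projIdeal P).toQuot.map (((projToCoker P).map σ).right - ((projToCoker P).map τ).right)) = 0
  · constructor
    · intro h
      have := congrArg (fun φ => φ.app (.op ((projIdeal P).toQuot.obj
        ((projToCoker P).obj f).right)) (𝟙 _)) h
      refine Eq.trans ?_ this
      exact congrArg ((stableCokerπ P g).app _) (Category.id_comp _).symm
    · intro h
      apply preadditiveYoneda_hom_ext
      refine Eq.trans ?_ h
      exact congrArg ((stableCokerπ P g).app _) (Category.id_comp ((projIdeal P).toQuot.map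
        (((projToCoker P).map σ).right - ((projToCoker P).map τ).right)))
  · rw [stableCokerπ_app_eq_zero_iff]
    have hsub : (coker A).map (σ - τ).hom =
        (((projToCoker P).map σ).right - ((projToCoker P).map τ).right).hom :=
      Functor.map_sub _
    constructor
    · rintro ⟨h, hh⟩
      exact ⟨h.hom, (congrArg (fun k => k.hom) hh).trans hsub.symm⟩
    · rintro ⟨h, hh⟩
      exact ⟨ObjectProperty.homMk h, by ext; exact hh.trans hsub⟩

/-- A morphism `Y ⟶ Y'` and a morphism between cokernels compatible with the projections come from
a morphism of `S_P(A)`. -/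
lemma exists_map_right_eq {f g : MonoCat P}
    (b : ((projToCoker P).obj f).left ⟶ ((projToCoker P).obj g).left)
    (c : ((projToCoker P).obj f).right ⟶ ((projToCoker P).obj g).right)
    (hbc : b ≫ ((projToCoker P).obj g).hom = ((projToCoker P).obj f).hom ≫ c) :
    ∃ σ : f ⟶ g, ((projToCoker P).map σ).right = c := by
  have : Mono g.obj.hom := g.property.1
  obtain ⟨b', rfl⟩ : ∃ b' : f.obj.right ⟶ g.obj.right, ObjectProperty.homMk b' = b := ⟨b.hom, rfl⟩
  have hb : b' ≫ cokernel.π g.obj.hom = cokernel.π f.obj.hom ≫ c.hom :=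
    congrArg (fun k => k.hom) hbc
  -- As `g` is a kernel of its cokernel, `b'` restricts to the sources.
  refine ⟨ObjectProperty.homMk (Arrow.homMk (Abelian.monoLift g.obj.hom (f.obj.hom ≫ b')
    ((Category.assoc _ _ _).trans ((congrArg (f.obj.hom ≫ ·) hb).trans
      ((cokernel.condition_assoc _ _).trans zero_comp)))) b'
    (Abelian.monoLift_comp _ _ _)), ?_⟩
  ext
  apply (cancel_epi (cokernel.π f.obj.hom)).1
  exact (cokernel.π_desc _ _ _).trans hb

/-- Lifting the image of the universal element gives `c`. The projection `p` of `f` represents zero,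
so `p ≫ c` does too and therefore lifts to some `b`. -/
instance : (stableCoker P).Full where
  map_surjective {f g} τ := by
    let q := (projIdeal P).toQuot
    let C := ((projToCoker P).obj f).right
    obtain ⟨c', hc'⟩ := app_surjective_of_epi (stableCokerπ P g) (.op (q.obj C))
      (τ.app _ ((stableCokerπ P f).app (.op (q.obj C)) (𝟙 (q.obj C))))
    obtain ⟨c, rfl⟩ := q.map_surjective c'
    have hτ : stableCokerπ P f ≫ τ = preadditiveYoneda.map (q.map c) ≫ stableCokerπ P g := by
      apply preadditiveYoneda_hom_ext
      refine hc'.symm.trans ?_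
      exact congrArg ((stableCokerπ P g).app _) (Category.id_comp _).symm
    obtain ⟨b, hb⟩ := (stableCokerπ_app_eq_zero_iff P g
      (((projToCoker P).obj f).hom ≫ c)).1 (by
        have h1 := (stableCokerπ_app_eq_zero_iff P f ((projToCoker P).obj f).hom).2
          ⟨𝟙 _, Category.id_comp _⟩
        have h2 := congrArg (fun φ => φ.app (.op (q.obj ((projToCoker P).obj f).left))
          (q.map ((projToCoker P).obj f).hom)) hτ
        refine Eq.trans h2.symm ?_
        exact (congrArg (τ.app _) h1).trans (map_zero _))
    obtain ⟨σ, rfl⟩ := exists_map_right_eq P b c hb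
    refine ⟨σ, ?_⟩
    rw [← cancel_epi (stableCokerπ P f), stableCokerπ_naturality, hτ]

end StableCoker

/-! ### Comparison of the cokernels over `P` and over its stable category -/

section Comparison

variable {A : Type u} [Category.{v} A] [Abelian A] (P : ObjectProperty A)

/-- The projection from the functor represented by `X` over `P` onto the one represented by `X`
over the stable category. -/
noncomputable def yonedaToStable (X : P.FullSubcategory) :
    preadditiveYoneda.obj X ⟶
      (projIdeal P).toQuot.op ⋙ preadditiveYoneda.obj ((projIdeal P).toQuot.obj X) where
  app Y := AddCommGrpCat.ofHom ((projIdeal P).toQuot.mapAddHom (X := Y.unop) (Y := X))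
  naturality Y Z g := by
    ext h
    exact (projIdeal P).toQuot.map_comp g.unop h

/-- The component at `f` of the comparison of `Psi` with `stableCoker`. -/
noncomputable def psiToStableCoker (f : MonoCat P) :
    (Psi P).obj f ⟶ (projIdeal P).toQuot.op ⋙ (stableCoker P).obj f :=
  cokernel.desc (preadditiveYoneda.map ((projToCoker P).obj f).hom)
    (yonedaToStable P _ ≫ Functor.whiskerLeft (projIdeal P).toQuot.op (stableCokerπ P f)) (by
      ext Y h
      exact (stableCokerπ_app_eq_zero_iff P f _).2 ⟨h, rfl⟩)

/-- The projection from the functor represented by `Coker f` onto the value of `Psi` at `f`. -/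
noncomputable def psiπ (f : MonoCat P) :
    preadditiveYoneda.obj ((projToCoker P).obj f).right ⟶ (Psi P).obj f :=
  cokernel.π (preadditiveYoneda.map ((projToCoker P).obj f).hom)

instance (f : MonoCat P) : Epi (psiπ P f) :=
  inferInstanceAs (Epi (cokernel.π _))

lemma psiπ_psiToStableCoker (f : MonoCat P) :
    psiπ P f ≫ psiToStableCoker P f = yonedaToStable P _ ≫
      Functor.whiskerLeft (projIdeal P).toQuot.op (stableCokerπ P f) :=
  cokernel.π_desc _ _ _

lemma psiπ_naturality {f g : MonoCat P} (σ : f ⟶ g) :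
    psiπ P f ≫ (Psi P).map σ =
      preadditiveYoneda.map ((projToCoker P).map σ).right ≫ psiπ P g :=
  cokernel.π_desc _ _ _

lemma psiToStableCoker_app_apply (f : MonoCat P) {Y : P.FullSubcategory}
    (g : Y ⟶ ((projToCoker P).obj f).right) :
    (psiToStableCoker P f).app (.op Y) ((psiπ P f).app (.op Y) g) =
      (stableCokerπ P f).app (.op ((projIdeal P).toQuot.obj Y)) ((projIdeal P).toQuot.map g) :=
  congrArg (fun φ => φ.app (.op Y) g) (psiπ_psiToStableCoker P f)

/-- On both sides, a morphism to `Coker f` represents zero exactly when it lifts along the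
projection. -/
instance (f : MonoCat P) : IsIso (psiToStableCoker P f) := by
  rw [NatTrans.isIso_iff_isIso_app]
  rintro ⟨Y⟩
  rw [ConcreteCategory.isIso_iff_bijective]
  constructor
  · refine (injective_iff_map_eq_zero ((psiToStableCoker P f).app (.op Y)).hom).2 fun x hx => ?_
    obtain ⟨g, rfl⟩ := app_surjective_of_epi (psiπ P f) _ x
    obtain ⟨h, hh⟩ := (stableCokerπ_app_eq_zero_iff P f g).1
      ((psiToStableCoker_app_apply P f g).symm.trans hx)
    exact (cokernel_π_app_eq_zero_iff _ _ _).2 ⟨h, hh⟩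
  · intro x
    obtain ⟨g', rfl⟩ := app_surjective_of_epi (stableCokerπ P f) _ x
    obtain ⟨g, rfl⟩ := (projIdeal P).toQuot.map_surjective g'
    exact ⟨(psiπ P f).app (.op Y) g, psiToStableCoker_app_apply P f g⟩

/-- `Psi` is the functor `stableCoker` followed by restriction along `P ⥤ StableCat P`. -/
noncomputable def psiIso :
    Psi P ≅ stableCoker P ⋙ (Functor.whiskeringLeft _ _ _).obj (projIdeal P).toQuot.op :=
  NatIso.ofComponents (fun f => asIso (psiToStableCoker P f)) (by
    intro f g σ
    apply (cancel_epi (psiπ P f)).1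
    ext Y h
    have h1 := congrArg (fun φ => φ.app Y h) (psiπ_naturality P σ)
    have h2 := congrArg (fun φ => φ.app (.op ((projIdeal P).toQuot.obj Y.unop))
      ((projIdeal P).toQuot.map h)) (stableCokerπ_naturality P σ)
    refine (congrArg ((psiToStableCoker P g).app Y) h1).trans ?_
    refine (psiToStableCoker_app_apply P g (h ≫ ((projToCoker P).map σ).right)).trans ?_
    refine h2.symm.trans ?_
    exact congrArg (((stableCoker P).map σ).app _) (psiToStableCoker_app_apply P f h).symm)

end Comparison

/-! ### Essential surjectivity -/

section EssSurj

variable {A : Type u} [Category.{v} A] [Abelian A] (P : ObjectProperty A)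

/-- An epimorphism of `P` is up to isomorphism the projection `Y ⟶ Coker f` for an object `f` of
`S_P(A)`. -/
lemma exists_projToCoker_iso [P.IsClosedUnderIsomorphisms] (hker : IsClosedUnderKernelsOfEpis P)
    {X Y : P.FullSubcategory} (p : X ⟶ Y) [Epi p.hom] :
    ∃ f : MonoCat P, Nonempty ((projToCoker P).obj f ≅ Arrow.mk p) := by
  have hp := Abelian.epiIsCokernelOfKernel _ (limit.isLimit (parallelPair p.hom 0))
  let e : cokernel (kernel.ι p.hom) ≅ Y.obj :=
    (cokernelIsCokernel (kernel.ι p.hom)).coconePointUniqueUpToIso hp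
  have he : cokernel.π (kernel.ι p.hom) ≫ e.hom = p.hom :=
    IsColimit.comp_coconePointUniqueUpToIso_hom (cokernelIsCokernel (kernel.ι p.hom)) hp
      WalkingParallelPair.one
  have hf : IsMonoIn P (Arrow.mk (kernel.ι p.hom)) :=
    ⟨inferInstanceAs (Mono (kernel.ι p.hom)), hker p.hom inferInstance X.property Y.property,
      X.property, P.prop_of_iso e.symm Y.property⟩
  refine ⟨⟨_, hf⟩, ⟨Arrow.isoMk (Iso.refl _) (P.isoMk e) ?_⟩⟩
  ext
  exact (Category.id_comp _).trans he.symm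

variable [EnoughProjectives A] [P.IsClosedUnderFiniteProducts]

/-- A morphism of the stable category extends, by a morphism from a projective object, to one that
is represented by an epimorphism. -/
lemma exists_epi_of_stable (hproj : ∀ X : A, Projective X → P X) {X Y : P.FullSubcategory}
    (a : (projIdeal P).toQuot.obj X ⟶ (projIdeal P).toQuot.obj Y) :
    ∃ (Z : P.FullSubcategory) (p : Z ⟶ Y) (i : X ⟶ Z)
      (r : (projIdeal P).toQuot.obj Z ⟶ (projIdeal P).toQuot.obj X),
      Epi p.hom ∧ (projIdeal P).toQuot.map (i ≫ p) = a ∧ (projIdeal P).toQuot.map p = r ≫ a := by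
  obtain ⟨a, rfl⟩ := (projIdeal P).toQuot.map_surjective a
  let Q : P.FullSubcategory := ⟨Projective.over Y.obj, hproj _ inferInstance⟩
  let π : Q ⟶ Y := ObjectProperty.homMk (Projective.π Y.obj)
  have hZ : P (X.obj ⊞ Q.obj) :=
    P.prop_of_isLimit (BinaryBiproduct.isLimit X.obj Q.obj) (by
      rintro ⟨_ | _⟩
      exacts [X.property, Q.property])
  let Z : P.FullSubcategory := ⟨X.obj ⊞ Q.obj, hZ⟩
  let p : Z ⟶ Y := ObjectProperty.homMk (biprod.desc a.hom π.hom)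
  let r : Z ⟶ X := ObjectProperty.homMk biprod.fst
  refine ⟨Z, p, ObjectProperty.homMk biprod.inl, (projIdeal P).toQuot.map r, ?_, ?_, ?_⟩
  · have : Epi (biprod.inr ≫ biprod.desc a.hom π.hom) := by
      rw [biprod.inr_desc]
      exact inferInstanceAs (Epi (Projective.π Y.obj))
    exact epi_of_epi biprod.inr (biprod.desc a.hom π.hom)
  · congr 1
    ext
    exact biprod.inl_desc _ _
  -- The difference `p - r ≫ a` is `biprod.snd ≫ π`, which passes through the projective `Q`.
  · rw [← Functor.map_comp, HomIdeal.toQuot_map_eq_iff]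
    refine ⟨Q.obj, inferInstanceAs (Projective (Projective.over Y.obj)), biprod.snd, π.hom, ?_⟩
    change biprod.snd ≫ π.hom = biprod.desc a.hom π.hom - biprod.fst ≫ a.hom
    rw [biprod.desc_eq, add_sub_cancel_left]

/-- In the stable category `a` and `p` factor through each other, so the same morphisms kill both
and their cokernels coincide. -/
lemma exists_stableCoker_iso [P.IsClosedUnderIsomorphisms]
    (hproj : ∀ X : A, Projective X → P X) (hker : IsClosedUnderKernelsOfEpis P) {F : (StableCat P)ᵒᵖ ⥤ AddCommGrpCat.{v}}
    (hF : IsFinPresModule (StableCat P) F) :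
    ∃ f : MonoCat P, Nonempty ((stableCoker P).obj f ≅ F) := by
  obtain ⟨-, ⟨X⟩, ⟨Y⟩, α, k, w, hex, hk⟩ := hF
  obtain ⟨a, rfl⟩ := preadditiveYoneda.map_surjective α
  obtain ⟨Z, p, i, r, hp, hi, hr⟩ := exists_epi_of_stable P hproj a
  obtain ⟨f, ⟨e⟩⟩ := exists_projToCoker_iso P hker p
  refine ⟨f, ⟨((projIdeal P).toQuot.mapArrow ⋙ preadditiveYoneda.mapArrow ⋙ coker _).mapIso e ≪≫
    ?_⟩⟩
  let q := preadditiveYoneda.map ((projIdeal P).toQuot.map p)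
  have hq : q ≫ k = 0 := by
    dsimp only [q]
    rw [hr, Functor.map_comp, Category.assoc]
    exact (congrArg _ w).trans comp_zero
  have hc {T} (t : preadditiveYoneda.obj ((projIdeal P).toQuot.obj Y) ⟶ T) (ht : q ≫ t = 0) :
      preadditiveYoneda.map a ≫ t = 0 := by
    rw [← hi, Functor.map_comp, Functor.map_comp, Category.assoc]
    exact (congrArg _ ht).trans comp_zero
  have hcol : IsColimit (CokernelCofork.ofπ k hq) :=
    CokernelCofork.IsColimit.ofπ k hq (fun t ht => hex.desc t (hc t ht))
      (fun t ht => hex.g_desc t (hc t ht))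
      (fun t ht m hm => (cancel_epi k).1 (hm.trans (hex.g_desc t (hc t ht)).symm))
  exact (cokernelIsCokernel q).coconePointUniqueUpToIso hcol

end EssSurj

theorem theorem1p2 {A : Type u} [Category.{v} A] [Abelian A] [EnoughProjectives A]
    (P : ObjectProperty A) [P.IsClosedUnderIsomorphisms] [P.IsClosedUnderFiniteProducts]
    (hproj : ∀ X : A, Projective X → P X)
    (hcf : IsContravariantlyFinite P)
    (hker : IsClosedUnderKernelsOfEpis P) :
    ∃ Φ : (idealV P).Quot ⥤ FinPresMod (StableCat P),
      Φ.IsEquivalence ∧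
        Nonempty ((idealV P).toQuot ⋙ Φ ⋙ stableRestrict P ≅ Psi P) := by
  let Φ₀ : MonoCat P ⥤ FinPresMod (StableCat P) :=
    (IsFinPresModule (StableCat P)).lift (stableCoker P) (stableCoker_isFinPresModule P)
  have hΦ₀ {f g : MonoCat P} (σ τ : f ⟶ g) : Φ₀.map σ = Φ₀.map τ ↔ (idealV P).rel σ τ := by
    refine Iff.trans ⟨fun h => congrArg (fun k => k.hom) h, fun h => ?_⟩
      (stableCoker_map_eq_iff P σ τ)
    ext1
    exact h
  have : Φ₀.Full := ⟨fun {f g} τ => by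
    obtain ⟨σ, hσ⟩ := (stableCoker P).map_surjective τ.hom
    exact ⟨σ, by ext1; exact hσ⟩⟩
  let Φ : (idealV P).Quot ⥤ FinPresMod (StableCat P) :=
    CategoryTheory.Quotient.lift _ Φ₀ fun _ _ σ τ h => (hΦ₀ σ τ).2 h
  have hfaithful : Φ.Faithful := ⟨fun {f g} σ τ h => by
    obtain ⟨σ, rfl⟩ := (idealV P).toQuot.map_surjective σ
    obtain ⟨τ, rfl⟩ := (idealV P).toQuot.map_surjective τ
    exact ((idealV P).toQuot_map_eq_iff σ τ).2 ((hΦ₀ σ τ).1 h)⟩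
  have hfull : Φ.Full := ⟨fun {f g} τ => by
    obtain ⟨σ, hσ⟩ := Φ₀.map_surjective (X := f.as) (Y := g.as) τ
    exact ⟨(idealV P).toQuot.map σ, hσ⟩⟩
  have hess : Φ.EssSurj := ⟨fun F => by
    obtain ⟨f, ⟨e⟩⟩ := exists_stableCoker_iso P hproj hker F.property
    exact ⟨(idealV P).toQuot.obj f, ⟨(IsFinPresModule (StableCat P)).isoMk e⟩⟩⟩
  -- The composite with `stableRestrict P` is by definition the restriction of `stableCoker P` along
  -- `P ⥤ StableCat P`.
  exact ⟨Φ, {}, ⟨(psiIso P).symm⟩⟩
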